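/- Let $d\ge 1$, let $\|\cdot\|$ be the Euclidean norm on $\mathbb{R}^d$, and let $\overline{B}_\rho(a)=\{x\in\mathbb{R}^d:\|x-a\|\le\rho\}$. Let $\psi:\mathbb{R}^d\to\mathbb{R}^d$ be a continuous function that satisfies the Aubry criterion with parameters $O\subset\mathbb{R}^d$, $R>0$, $r>0$ and $m>0$, that is: (a) every closed ball of radius $R$ in $\mathbb{R}^d$ contains at least one point of $O$; (b) $\psi(z)=0$ for all $z\in O$; (c) for every $z\in O$ and all $x,y\in\overline{B}_r(z)$, $\|\psi(x)-\psi(y)\|\ge m\|x-y\|$. Then for every $z\in O$ there exists a function $\varphi_z:\overline{B}_{rm}(0)\to\overline{B}_r(z)$ such that (i) $\psi(\varphi_z(x))=x$ for all $x\in\overline{B}_{rm}(0)$; (ii) $\|\varphi_z(x)-\varphi_z(y)\|\le\frac{1}{m}\|x-y\|$ for all $x,y\in\overline{B}_{rm}(0)$. -/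

import Mathlib

/-- A map `ψ : ℝ^d → ℝ^d` (Euclidean norm) satisfies the Aubry criterion with parameters
`O`, `R`, `r`, `m`. The continuity of `ψ` is assumed separately. -/
structure AubryCriterion {d : ℕ}
    (ψ : EuclideanSpace ℝ (Fin d) → EuclideanSpace ℝ (Fin d))
    (O : Set (EuclideanSpace ℝ (Fin d))) (R r m : ℝ) : Prop where
  R_pos : 0 < R
  r_pos : 0 < r
  m_pos : 0 < m
  /-- Every ball of radius `R` contains a point of `O`. -/
  relatively_dense : ∀ c : EuclideanSpace ℝ (Fin d), ∃ z ∈ O, z ∈ Metric.closedBall c R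
  /-- `ψ` vanishes on `O`. -/
  zero_on : ∀ z ∈ O, ψ z = 0
  /-- `ψ` expands distances at least by the factor `m` on the closed `r`-ball about each
  point of `O`. -/
  expansion : ∀ z ∈ O, ∀ x ∈ Metric.closedBall z r, ∀ y ∈ Metric.closedBall z r,
    m * ‖x - y‖ ≤ ‖ψ x - ψ y‖

/-! Expansion makes `ψ` injective on the closed `r`-ball about `z`, with `1/m`-Lipschitz inverse, so
it suffices that the image covers the `r * m`-ball
(`closedBall_subset_image_closedBall_of_expanding`). If a point is missed, some `c` outside the
image is closer to an image point than to the image of the boundary sphere. Push the image radially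
out of a ball about `c`, then apply a Lipschitz extension of the inverse. The result, extended by
the identity, is continuous, hence surjective; but it reaches a nonempty open set only through a
Lipschitz image of a sphere, which is null.

Surjectivity is a no-retraction argument by volume: if a map equal to the identity off a ball
omitted 0, smoothing and normalising would give `F = id + g` with values in a sphere. For small `t`,
`id + t g` permutes the ball, so the integral of `det (1 + t Dg)` is its volume. This integral is
polynomial in `t`, so the same holds at `t = 1`, where the determinant vanishes. -/

/-! ### Volume of perturbations of the identity -/

open Module Polynomial in
/-- The value of `det (1 + s • A)` at `s = 1` is a linear combination, with coefficients
independent of `A`, of its values at sufficiently many prescribed nodes `s`. -/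
theorem exists_det_one_add_eq_sum {E : Type*} [NormedAddCommGroup E] [NormedSpace ℝ E]
    [FiniteDimensional ℝ E] (T : Finset ℝ) (hT : finrank ℝ E < T.card) :
    ∃ w : ℝ → ℝ, ∀ A : E →L[ℝ] E,
      (1 + A).det = ∑ s ∈ T, w s * (1 + s • A).det := by
  -- The determinant is polynomial in `s` of degree at most the dimension, so Lagrange interpolation
  -- at `T` recovers its value at 1.
  refine ⟨fun s => (Lagrange.basis T id s).eval 1, fun A => ?_⟩
  let b := finBasis ℝ E
  let M := LinearMap.toMatrix b b (A : E →ₗ[ℝ] E)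
  let P : ℝ[X] := ((X : ℝ[X]) • M.map C + (1 : Matrix _ _ ℝ).map C).det
  have hP (s : ℝ) : P.eval s = (1 + s • A).det := by
    have h1 : (1 + s • A).det = (1 + s • M).det := by
      rw [ContinuousLinearMap.det, ← LinearMap.det_toMatrix b]
      congr 1
      simp [M, LinearMap.toMatrix_one]
    rw [h1, ← coe_evalRingHom, RingHom.map_det]
    congr 1
    ext i j
    by_cases hij : i = j <;> simp [hij] <;> ring
  have hdeg : P.degree < T.card := by
    refine lt_of_le_of_lt degree_le_natDegree ?_
    have : P.natDegree ≤ finrank ℝ E := by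
      exact (natDegree_det_X_add_C_le M 1).trans_eq (Fintype.card_fin _)
    exact_mod_cast this.trans_lt hT
  have hI := congrArg (eval 1) (Lagrange.eq_interpolate (s := T) (v := id)
    Function.injective_id.injOn hdeg)
  rw [hP, one_smul, Lagrange.interpolate_apply, eval_finsetSum] at hI
  rw [hI]
  refine Finset.sum_congr rfl fun s _ => ?_
  simp [hP, mul_comm]

open Metric Set NNReal in
/-- A small Lipschitz perturbation of the identity that is supported in a ball maps that ball
bijectively onto itself. -/
theorem LipschitzWith.bijOn_ball_add_smul {E : Type*} [NormedAddCommGroup E] [NormedSpace ℝ E]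
    [CompleteSpace E] {g : E → E} {K : ℝ≥0} (hg : LipschitzWith K g) {ρ : ℝ}
    (hg0 : ∀ x, ρ ≤ ‖x‖ → g x = 0) {t : ℝ≥0} (ht : t * K < 1) :
    BijOn (fun x => x + (t : ℝ) • g x) (ball 0 ρ) (ball 0 ρ) := by
  have hlip : LipschitzWith (t * K) fun x => (t : ℝ) • g x := by
    refine LipschitzWith.of_dist_le_mul fun x y => ?_
    rw [dist_smul₀, NNReal.coe_mul, mul_assoc, NNReal.norm_eq]
    exact mul_le_mul_of_nonneg_left (hg.dist_le_mul x y) t.2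
  have hinj : Function.Injective fun x => x + (t : ℝ) • g x := by
    intro x y hxy
    have h1 : x - y = (t : ℝ) • g y - (t : ℝ) • g x := by
      have : x + (t : ℝ) • g x = y + (t : ℝ) • g y := hxy
      rw [sub_eq_sub_iff_add_eq_add, this, add_comm]
    have h2 : dist x y ≤ (t * K : ℝ≥0) * dist x y := by
      calc dist x y = dist ((t : ℝ) • g y) ((t : ℝ) • g x) := by rw [dist_eq_norm, h1, dist_eq_norm]
        _ ≤ _ := hlip.dist_le_mul y x
        _ = _ := by rw [dist_comm]
    have h3 : ((t * K : ℝ≥0) : ℝ) < 1 := by exact_mod_cast ht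
    have h4 := dist_nonneg (x := x) (y := y)
    exact dist_le_zero.1 (by nlinarith)
  refine ⟨?_, hinj.injOn, ?_⟩
  · intro x hx
    by_contra hc
    rw [mem_ball_zero_iff, not_lt] at hc
    -- The image point lies where `g` vanishes, so the map fixes it; injectivity identifies it with
    -- `x`.
    have : x + (t : ℝ) • g x = x := hinj (by simp [hg0 _ hc])
    simp only [this] at hc
    exact absurd (mem_ball_zero_iff.1 hx) (not_lt.2 hc)
  · intro y hy
    have hc : ContractingWith (t * K) fun x => y - (t : ℝ) • g x := by
      refine ⟨ht, LipschitzWith.of_dist_le_mul fun a b => ?_⟩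
      rw [dist_sub_left]
      exact hlip.dist_le_mul a b
    obtain ⟨x, hx⟩ : ∃ x, x + (t : ℝ) • g x = y := by
      refine ⟨hc.fixedPoint, ?_⟩
      have := hc.fixedPoint_isFixedPt
      exact eq_sub_iff_add_eq.1 this.symm
    refine ⟨x, ?_, hx⟩
    by_contra hc
    rw [mem_ball_zero_iff, not_lt] at hc
    rw [hg0 x hc, smul_zero, add_zero] at hx
    rw [hx] at hc
    exact absurd (mem_ball_zero_iff.1 hy) (not_lt.2 hc)

open MeasureTheory Metric Set NNReal Module in
/-- A Lipschitz perturbation of the identity supported in a ball and differentiable inside cannot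
be singular at every point of the ball. -/
theorem LipschitzWith.exists_det_fderiv_ne_zero {E : Type*} [NormedAddCommGroup E]
    [NormedSpace ℝ E] [FiniteDimensional ℝ E] {g : E → E} {K : ℝ≥0} (hg : LipschitzWith K g)
    {ρ : ℝ} (hρ : 0 < ρ) (hg0 : ∀ x, ρ ≤ ‖x‖ → g x = 0)
    (hd : ∀ x ∈ ball (0 : E) ρ, DifferentiableAt ℝ g x) :
    ∃ x ∈ ball (0 : E) ρ, (1 + fderiv ℝ g x).det ≠ 0 := by
  by_contra! hdet
  borelize E
  let μ : Measure E := Measure.addHaar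
  have hdet0 : ContinuousAt (fun B : E →L[ℝ] E => B.det) 1 :=
    ContinuousLinearMap.continuous_det.continuousAt
  obtain ⟨ε, hε, hpos⟩ : ∃ ε > 0, ∀ B : E →L[ℝ] E, dist B 1 < ε → 0 < B.det := by
    have : ∀ᶠ B : E →L[ℝ] E in nhds 1, 0 < B.det :=
      hdet0.eventually (lt_mem_nhds (by
        exact one_pos.trans_eq (LinearMap.det_id (M := E) (A := ℝ)).symm))
    exact Metric.eventually_nhds_iff.1 this
  obtain ⟨δ, hδ, hδ1, hδε⟩ : ∃ δ : ℝ, 0 < δ ∧ δ * K < 1 ∧ δ * K < ε := by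
    refine ⟨min 1 ε / (K + 1), by positivity, ?_, ?_⟩
    all_goals
      rw [div_mul_eq_mul_div, div_lt_iff₀ (by positivity)]
      have := K.2
      have h1 := min_le_left 1 ε
      have h2 := min_le_right 1 ε
      have h3 : 0 < min 1 ε := by positivity
      change min 1 ε * (K : ℝ) < _
      nlinarith [show (0 : ℝ) ≤ (K : ℝ) from this]
  -- All nodes lie below `δ`, where the perturbed map is a bijection of the ball with positive
  -- Jacobian.
  obtain ⟨T, hTsub, hTcard⟩ := (Ioo_infinite hδ).exists_subset_card_eq (finrank ℝ E + 1)
  obtain ⟨w, hw⟩ := exists_det_one_add_eq_sum (E := E) T (by omega)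
  have key : ∀ t ∈ T, IntegrableOn (fun x => (1 + t • fderiv ℝ g x).det) (ball 0 ρ) μ ∧
      ∫ x in ball 0 ρ, (1 + t • fderiv ℝ g x).det ∂μ = μ.real (ball 0 ρ) := by
    intro t ht
    have htI : t ∈ Ioo 0 δ := hTsub ht
    have htK : t * K ≤ δ * K := mul_le_mul_of_nonneg_right htI.2.le K.2
    have hbij := hg.bijOn_ball_add_smul hg0 (t := ⟨t, htI.1.le⟩) (by
      rw [← NNReal.coe_lt_coe]
      exact htK.trans_lt hδ1)
    have hder : ∀ x ∈ ball (0 : E) ρ, HasFDerivWithinAt (fun x => x + t • g x)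
        (1 + t • fderiv ℝ g x) (ball 0 ρ) x := fun x hx =>
      ((hasFDerivAt_id x).add ((hd x hx).hasFDerivAt.const_smul t)).hasFDerivWithinAt
    have habs : ∀ x ∈ ball (0 : E) ρ,
        |(1 + t • fderiv ℝ g x).det| • (1 : ℝ) = (1 + t • fderiv ℝ g x).det := by
      intro x _
      rw [smul_eq_mul, mul_one, abs_of_pos]
      apply hpos
      rw [dist_eq_norm, add_sub_cancel_left, norm_smul, Real.norm_of_nonneg htI.1.le]
      exact (mul_le_mul_of_nonneg_left (norm_fderiv_le_of_lipschitz ℝ hg) htI.1.le).trans_lt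
        (htK.trans_lt hδε)
    have himg : (fun x => x + t • g x) '' ball 0 ρ = ball 0 ρ := hbij.image_eq
    have hint := integrableOn_image_iff_integrableOn_abs_det_fderiv_smul μ measurableSet_ball
      hder hbij.injOn (fun _ => (1 : ℝ))
    have hval := integral_image_eq_integral_abs_det_fderiv_smul μ measurableSet_ball
      hder hbij.injOn (fun _ => (1 : ℝ))
    rw [himg] at hint hval
    rw [setIntegral_congr_fun measurableSet_ball habs] at hval
    rw [integrableOn_congr_fun habs measurableSet_ball] at hint
    refine ⟨hint.1 (integrableOn_const measure_ball_lt_top.ne), ?_⟩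
    rw [← hval]
    simp
  have h1 : ∫ x in ball 0 ρ, (1 + fderiv ℝ g x).det ∂μ = 0 := by
    rw [setIntegral_congr_fun measurableSet_ball hdet]
    simp
  have hsum : ∑ s ∈ T, w s = 1 := by
    have hdet1 : (1 : E →L[ℝ] E).det = 1 := LinearMap.det_id
    have := hw 0
    simp only [smul_zero, add_zero, hdet1, mul_one] at this
    exact this.symm
  have h2 : ∫ x in ball 0 ρ, (1 + fderiv ℝ g x).det ∂μ = μ.real (ball 0 ρ) := by
    rw [funext fun x => hw (fderiv ℝ g x), integral_finsetSum _ fun t ht => (key t ht).1.const_mul _]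
    simp_rw [integral_const_mul]
    rw [Finset.sum_congr rfl fun t ht => by rw [(key t ht).2], ← Finset.sum_mul, hsum, one_mul]
  have h3 : 0 < μ.real (ball 0 ρ) :=
    ENNReal.toReal_pos (measure_ball_pos μ 0 hρ).ne' measure_ball_lt_top.ne
  linarith

open Metric Set NNReal in
/-- A function that is Lipschitz on a ball and vanishes off the open ball is Lipschitz. -/
theorem LipschitzOnWith.lipschitzWith_of_eq_zero {E F : Type*} [NormedAddCommGroup E]
    [NormedSpace ℝ E] [NormedAddCommGroup F] {g : E → F} {K : ℝ≥0} {ρ : ℝ}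
    (hg : LipschitzOnWith K g (closedBall 0 ρ)) (hg0 : ∀ x, ρ ≤ ‖x‖ → g x = 0) :
    LipschitzWith K g := by
  have mixed : ∀ x y, ‖x‖ ≤ ρ → ρ ≤ ‖y‖ → dist (g x) (g y) ≤ K * dist x y := by
    intro x y hx hy
    have hcont : ContinuousOn (fun c : ℝ => ‖AffineMap.lineMap x y c‖) (Icc 0 1) := by
      have : Continuous (fun c : ℝ => AffineMap.lineMap x y c) := AffineMap.lineMap_continuous
      exact this.norm.continuousOn
    -- The segment crosses the sphere of radius `ρ`, where `g` is already zero.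
    obtain ⟨c, hc, hcρ⟩ := intermediate_value_Icc zero_le_one hcont
      (show ρ ∈ Icc _ _ by simpa using And.intro hx hy)
    have hp := hg.dist_le_mul x (by simpa using hx) (AffineMap.lineMap x y c)
      (by simpa using hcρ.le)
    rw [hg0 _ hcρ.ge, dist_left_lineMap, Real.norm_of_nonneg hc.1] at hp
    rw [hg0 y hy]
    refine hp.trans (mul_le_mul_of_nonneg_left ?_ K.2)
    exact mul_le_of_le_one_left dist_nonneg hc.2
  refine LipschitzWith.of_dist_le_mul fun x y => ?_
  rcases le_total ‖x‖ ρ with hx | hx <;> rcases le_total ‖y‖ ρ with hy | hy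
  · exact hg.dist_le_mul x (by simpa using hx) y (by simpa using hy)
  · exact mixed x y hx hy
  · rw [dist_comm, dist_comm x]
    exact mixed y x hy hx
  · rw [hg0 x hx, hg0 y hy, dist_self]
    positivity

/-! ### No retraction, and surjectivity -/

/-- The derivative of a map into a sphere is singular. -/
theorem det_fderiv_eq_zero_of_norm_eq {E : Type*} [NormedAddCommGroup E] [InnerProductSpace ℝ E]
    [FiniteDimensional ℝ E] {f : E → E} {f' : E →L[ℝ] E} {x : E} {ρ : ℝ} (hρ : 0 < ρ)
    (hf : HasFDerivAt f f' x) (hnorm : ∀ y, ‖f y‖ = ρ) : f'.det = 0 := by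
  by_contra hdet
  -- Differentiating the constant `‖f‖ ^ 2` shows that the range of `f'` is orthogonal to `f x ≠ 0`.
  have h1 := hf.norm_sq
  simp_rw [hnorm] at h1
  have h2 := h1.unique (hasFDerivAt_const (ρ ^ 2) x)
  have hsurj : Function.Surjective (f' : E →ₗ[ℝ] E) :=
    (LinearMap.equivOfDetNeZero (f' : E →ₗ[ℝ] E) hdet).surjective
  obtain ⟨v, hv⟩ := hsurj (f x)
  have h3 := DFunLike.congr_fun h2 v
  have hv' : f' v = f x := hv
  simp [hv', hnorm] at h3
  exact hρ.ne' h3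

open Metric Set NNReal in
/-- A continuous map that is the identity off a ball has a zero. -/
theorem exists_eq_zero_of_eq_id_off_ball {E : Type*} [NormedAddCommGroup E]
    [InnerProductSpace ℝ E] [FiniteDimensional ℝ E] {H : E → E} (hH : Continuous H) {ρ : ℝ}
    (hρ : 0 < ρ) (hid : ∀ x, ρ ≤ ‖x‖ → H x = x) : ∃ x, H x = 0 := by
  by_contra! hne
  obtain ⟨δ, hδ, hHδ⟩ : ∃ δ > 0, ∀ x, δ ≤ ‖H x‖ := by
    obtain ⟨x₀, -, hx₀⟩ := (isCompact_closedBall (0 : E) ρ).exists_isMinOn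
      ⟨0, by simpa using hρ.le⟩ hH.norm.continuousOn
    refine ⟨min ‖H x₀‖ ρ, lt_min (norm_pos_iff.2 (hne x₀)) hρ, fun x => ?_⟩
    rcases le_total ‖x‖ ρ with hx | hx
    · exact (min_le_left _ _).trans (hx₀ (by simpa using hx))
    · rw [hid x hx]
      exact (min_le_right _ _).trans hx
  -- Approximating `H - id` within its support keeps the map the identity off the ball; an error
  -- below `δ` keeps it nonzero.
  obtain ⟨v, hv, hvdist, hvsupp⟩ := (hH.sub continuous_id).exists_contDiff_approx 1
    (ε := fun _ => δ) continuous_const (fun _ => hδ)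
  have hv0 : ∀ x, ρ ≤ ‖x‖ → v x = 0 := by
    intro x hx
    by_contra hvx
    exact hvsupp hvx (by simp [hid x hx])
  let G : E → E := fun x => x + v x
  have hG : ContDiff ℝ 1 G := contDiff_id.add hv
  have hGne : ∀ x, G x ≠ 0 := by
    intro x hx
    have h1 := hvdist x
    have h2 : v x = -x := eq_neg_of_add_eq_zero_right hx
    rw [h2, dist_eq_norm, Pi.sub_apply, id_eq, show -x - (H x - x) = -H x by abel, norm_neg] at h1
    exact absurd (hHδ x) (not_le.2 h1)
  let F : E → E := fun x => (ρ / ‖G x‖) • G x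
  have hF : ContDiff ℝ 1 F :=
    (contDiff_const.div (hG.norm ℝ hGne) fun x => norm_ne_zero_iff.2 (hGne x)).smul hG
  have hFnorm : ∀ x, ‖F x‖ = ρ := by
    intro x
    have := norm_ne_zero_iff.2 (hGne x)
    simp only [F, norm_smul, norm_div, norm_norm, Real.norm_of_nonneg hρ.le]
    field_simp
  classical
  let g : E → E := fun x => if ‖x‖ ≤ ρ then F x - x else 0
  have hgF : ∀ x, ‖x‖ ≤ ρ → g x = F x - x := fun x hx => if_pos hx
  have hg0 : ∀ x, ρ ≤ ‖x‖ → g x = 0 := by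
    intro x hx
    rcases hx.eq_or_lt with h | h
    · rw [hgF x h.ge]
      simp only [F, G, hv0 x hx, add_zero, ← h, div_self hρ.ne', one_smul, sub_self]
    · exact if_neg (not_le.2 h)
  obtain ⟨K, hK⟩ : ∃ K, LipschitzOnWith K g (closedBall 0 ρ) := by
    obtain ⟨K, hK⟩ := ((hF.sub contDiff_id).locallyLipschitz.locallyLipschitzOn
      (s := closedBall (0 : E) ρ)).exists_lipschitzOnWith_of_compact (isCompact_closedBall _ _)
    refine ⟨K, fun x hx y hy => ?_⟩
    rw [hgF x (by simpa using hx), hgF y (by simpa using hy)]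
    exact hK hx hy
  have hgder : ∀ x ∈ ball (0 : E) ρ, HasFDerivAt g (fderiv ℝ F x - 1) x := by
    intro x hx
    have h1 : HasFDerivAt (fun x => F x - x) (fderiv ℝ F x - 1) x :=
      ((hF.differentiable one_ne_zero) x).hasFDerivAt.sub (hasFDerivAt_id x)
    refine h1.congr_of_eventuallyEq ?_
    filter_upwards [isOpen_ball.mem_nhds hx] with y hy
    exact hgF y (by simpa using (mem_ball_zero_iff.1 hy).le)
  obtain ⟨x, hx, hdet⟩ := (hK.lipschitzWith_of_eq_zero hg0).exists_det_fderiv_ne_zero hρ hg0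
    fun x hx => (hgder x hx).differentiableAt
  rw [(hgder x hx).fderiv, add_sub_cancel] at hdet
  exact hdet (det_fderiv_eq_zero_of_norm_eq hρ
    ((hF.differentiable one_ne_zero) x).hasFDerivAt hFnorm)

/-- A continuous map that is the identity off a ball is surjective. -/
theorem Continuous.surjective_of_eq_id_off_ball {E : Type*} [NormedAddCommGroup E]
    [InnerProductSpace ℝ E] [FiniteDimensional ℝ E] {H : E → E} (hH : Continuous H) {z : E} {ρ : ℝ}
    (hid : ∀ x, ρ ≤ dist x z → H x = x) : Function.Surjective H := by
  intro p
  have hcont : Continuous fun x => H (x + p) - p := by fun_prop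
  obtain ⟨x, hx⟩ := exists_eq_zero_of_eq_id_off_ball hcont (ρ := |ρ| + dist z p + 1)
    (by positivity) fun x hx => by
      rw [hid (x + p), add_sub_cancel_right]
      have h1 : ‖x‖ = dist (x + p) p := by simp [dist_eq_norm]
      have h2 := dist_triangle (x + p) z p
      have := le_abs_self ρ
      linarith
  exact ⟨x + p, sub_eq_zero.1 hx⟩

/-! ### Covering by expanding maps -/

open Metric Set NNReal MeasureTheory Module in
/-- The Lipschitz image of a sphere of nonzero radius has empty interior. -/
theorem LipschitzWith.not_subset_image_sphere {E : Type*} [NormedAddCommGroup E]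
    [NormedSpace ℝ E] [FiniteDimensional ℝ E] {G : E → E} {K : ℝ≥0} (hG : LipschitzWith K G)
    {c : E} {ε : ℝ} (hε : ε ≠ 0) {U : Set E} (hU : IsOpen U) (hne : U.Nonempty) :
    ¬ U ⊆ G '' sphere c ε := by
  borelize E
  intro hsub
  have h0 : Measure.hausdorffMeasure (finrank ℝ E : ℝ) (G '' sphere c ε) = 0 := by
    refine le_antisymm ((hG.hausdorffMeasure_image_le (Nat.cast_nonneg _) _).trans ?_) zero_le
    rw [Measure.addHaar_sphere_of_ne_zero _ c hε, mul_zero]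
  exact (hU.measure_pos (Measure.hausdorffMeasure (finrank ℝ E : ℝ)) hne).ne'
    (measure_mono_null hsub h0)

open Metric Set NNReal in
/-- A continuous map that expands distances at least by the factor `m` on the closed ball of
radius `r` about `z` covers the closed ball of radius `r * m` about the image of `z`. -/
theorem closedBall_subset_image_closedBall_of_expanding {E : Type*} [NormedAddCommGroup E]
    [InnerProductSpace ℝ E] [FiniteDimensional ℝ E] {f : E → E} {z : E} {r m : ℝ} (hr : 0 < r)
    (hm : 0 < m) (hf : ContinuousOn f (closedBall z r))
    (hexp : ∀ x ∈ closedBall z r, ∀ y ∈ closedBall z r, m * dist x y ≤ dist (f x) (f y)) :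
    closedBall (f z) (r * m) ⊆ f '' closedBall z r := by
  intro y hy
  by_contra hyK
  have hzB : z ∈ closedBall z r := mem_closedBall_self hr.le
  have hK : IsCompact (f '' closedBall z r) := (isCompact_closedBall z r).image_of_continuousOn hf
  have hline : Continuous (AffineMap.lineMap (f z) y : ℝ → E) := AffineMap.lineMap_continuous
  have hD : 0 < dist (f z) y := dist_pos.2 fun h => hyK ⟨z, hzB, h⟩
  obtain ⟨a, ⟨ha, haK⟩, hamax⟩ : ∃ a, IsGreatest
      (Icc (0 : ℝ) 1 ∩ (AffineMap.lineMap (f z) y : ℝ → E) ⁻¹' (f '' closedBall z r)) a :=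
    (isCompact_Icc.inter_right (hK.isClosed.preimage hline)).exists_isGreatest
      ⟨0, by simp, z, hzB, by simp⟩
  have ha1 : a < 1 := by
    refine ha.2.lt_of_ne fun h => hyK ?_
    simpa [h] using haK
  obtain ⟨x₀, hx₀, hfx₀⟩ := haK
  -- One third of the way from `a` to 1, so that `t - a < 1 - t`: this puts `f x₀` within `ε` of
  -- `c`.
  let t : ℝ := (2 * a + 1) / 3
  have hat : a < t := by simp only [t]; linarith
  have ht1 : t < 1 := by simp only [t]; linarith
  have ht0 : 0 < t := ha.1.trans_lt hat
  let c : E := AffineMap.lineMap (f z) y t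
  have hcK : c ∉ f '' closedBall z r := fun h =>
    absurd (hamax ⟨⟨ht0.le, ht1.le⟩, h⟩) (not_le.2 hat)
  let ε : ℝ := (1 - t) * dist (f z) y
  have hε : 0 < ε := mul_pos (by linarith) hD
  have hx₀c : dist (f x₀) c < ε := by
    rw [hfx₀, dist_lineMap_lineMap, Real.dist_eq, abs_of_neg (by linarith)]
    exact mul_lt_mul_of_pos_right (by simp only [t]; linarith) hD
  have hsphere : ∀ x, dist x z = r → ε ≤ dist (f x) c := by
    intro x hx
    have h1 := hexp x (by simp [hx]) z hzB
    have h2 := dist_triangle (f x) c (f z)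
    have h3 : dist c (f z) = t * dist (f z) y := by
      rw [dist_lineMap_left, Real.norm_of_nonneg ht0.le]
    have h4 : dist (f z) y ≤ r * m := by rw [dist_comm]; exact hy
    rw [hx] at h1
    simp only [ε]
    linarith
  have hx₀z : x₀ ∈ ball z r := by
    refine lt_of_le_of_ne (mem_closedBall.1 hx₀) fun h => ?_
    exact absurd (hsphere x₀ h) (not_le.2 hx₀c)
  have hinj : InjOn f (closedBall z r) := by
    intro u hu v hv huv
    have := hexp u hu v hv
    rw [huv, dist_self] at this
    exact dist_le_zero.1 (nonpos_of_mul_nonpos_right this hm)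
  obtain ⟨G, L, hG, hGf⟩ : ∃ (G : E → E) (L : ℝ≥0), LipschitzWith L G ∧
      ∀ x ∈ closedBall z r, G (f x) = x := by
    have hinv := hinj.leftInvOn_invFunOn
    have hlip : LipschitzOnWith ⟨m⁻¹, (inv_pos.2 hm).le⟩ (Function.invFunOn f (closedBall z r))
        (f '' closedBall z r) := by
      refine LipschitzOnWith.of_dist_le_mul ?_
      rintro _ ⟨u, hu, rfl⟩ _ ⟨v, hv, rfl⟩
      rw [hinv hu, hinv hv]
      change _ ≤ m⁻¹ * _
      rw [le_inv_mul_iff₀ hm]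
      exact hexp u hu v hv
    obtain ⟨G, hG, hGeq⟩ := hlip.extend_finite_dimension
    exact ⟨G, _, hG, fun x hx => (hGeq ⟨x, hx, rfl⟩).symm.trans (hinv hx)⟩
  -- Radial push of the punctured `ε`-ball onto its sphere, fixing everything outside; the
  -- discontinuity at `c` is harmless since `f` omits `c`.
  let Φ : E → E := fun w => c + max 1 (ε / dist w c) • (w - c)
  have hΦfar : ∀ w, ε ≤ dist w c → Φ w = w := by
    intro w hw
    have : ε / dist w c ≤ 1 := div_le_one_of_le₀ hw dist_nonneg
    simp [Φ, max_eq_left this]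
  have hΦnear : ∀ w, w ≠ c → dist w c < ε → Φ w ∈ sphere c ε := by
    intro w hwc hw
    have hpos : 0 < dist w c := dist_pos.2 hwc
    have h1 : 1 ≤ ε / dist w c := (one_le_div hpos).2 hw.le
    rw [mem_sphere, dist_eq_norm]
    simp only [Φ, max_eq_right h1, add_sub_cancel_left, norm_smul, norm_div, ← dist_eq_norm]
    rw [Real.norm_of_nonneg hε.le, Real.norm_of_nonneg hpos.le, div_mul_cancel₀ _ hpos.ne']
  have hΦcont : ContinuousOn Φ {c}ᶜ := by
    have : ContinuousOn (fun w => ε / dist w c) {c}ᶜ :=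
      continuousOn_const.div (by fun_prop) fun w hw => (dist_pos.2 hw).ne'
    exact continuousOn_const.add ((continuousOn_const.sup this).smul (by fun_prop))
  classical
  let H : E → E := fun x => if dist x z ≤ r then G (Φ (f x)) else x
  have hH : Continuous H := by
    refine continuous_if_le (by fun_prop) continuous_const ?_ continuousOn_id ?_
    · exact hG.continuous.comp_continuousOn (hΦcont.comp hf fun x hx h => hcK ⟨x, hx, h⟩)
    · intro x hx
      rw [hΦfar _ (hsphere x hx), hGf x hx.le]
  have hHfar : ∀ x, r ≤ dist x z → H x = x := by
    intro x hx
    rcases hx.eq_or_lt with h | h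
    · simp only [H, if_pos h.ge, hΦfar _ (hsphere x h.symm), hGf x h.ge]
    · exact if_neg (not_le.2 h)
  have hsurj := hH.surjective_of_eq_id_off_ball hHfar
  have hU : IsOpen (ball z r ∩ f ⁻¹' ball c ε) :=
    (hf.mono ball_subset_closedBall).isOpen_inter_preimage isOpen_ball isOpen_ball
  -- Points that `H` fixes are either outside the open `r`-ball or have `f`-value outside the
  -- `ε`-ball, so this set is reached only through `sphere c ε`.
  refine hG.not_subset_image_sphere (c := c) hε.ne' hU ⟨x₀, hx₀z, hx₀c⟩ ?_
  rintro u ⟨huB, huc⟩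
  obtain ⟨x, rfl⟩ := hsurj u
  rcases lt_or_ge r (dist x z) with hx | hx
  · rw [hHfar x hx.le] at huB
    exact absurd huB (not_lt.2 hx.le)
  · have hHx : H x = G (Φ (f x)) := if_pos hx
    rcases lt_or_ge (dist (f x) c) ε with h | h
    · exact ⟨Φ (f x), hΦnear _ (fun h => hcK ⟨x, hx, h⟩) h, hHx.symm⟩
    · rw [hHx, hΦfar _ h, hGf x hx] at huc
      exact absurd huc (not_lt.2 h)

theorem proposition2p1 (d : ℕ) (hd : 0 < d)
    (ψ : EuclideanSpace ℝ (Fin d) → EuclideanSpace ℝ (Fin d)) (hψ : Continuous ψ)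
    (O : Set (EuclideanSpace ℝ (Fin d))) (R r m : ℝ) (h : AubryCriterion ψ O R r m)
    (z : EuclideanSpace ℝ (Fin d)) (hz : z ∈ O) :
    ∃ φ : Metric.closedBall (0 : EuclideanSpace ℝ (Fin d)) (r * m) → Metric.closedBall z r,
      (∀ x, ψ (φ x : EuclideanSpace ℝ (Fin d)) = (x : EuclideanSpace ℝ (Fin d))) ∧
      ∀ x y, ‖(φ x : EuclideanSpace ℝ (Fin d)) - (φ y : EuclideanSpace ℝ (Fin d))‖ ≤
        (1 / m) * ‖(x : EuclideanSpace ℝ (Fin d)) - (y : EuclideanSpace ℝ (Fin d))‖ := by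
  have hcover := closedBall_subset_image_closedBall_of_expanding h.r_pos h.m_pos hψ.continuousOn
    (fun x hx y hy => by simpa only [dist_eq_norm] using h.expansion z hz x hx y hy)
  rw [h.zero_on z hz] at hcover
  choose φ hφB hφ using fun x : Metric.closedBall (0 : EuclideanSpace ℝ (Fin d)) (r * m) =>
    hcover x.2
  refine ⟨fun x => ⟨φ x, hφB x⟩, hφ, fun x y => ?_⟩
  have := h.expansion z hz _ (hφB x) _ (hφB y)
  rw [hφ, hφ] at this
  rwa [one_div, le_inv_mul_iff₀ h.m_pos]
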